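/- Let $\mathcal H$ be the upper half plane and $\mathrm{Mer}$ the algebra of meromorphic functions on $\mathcal H$. Write $f'=\frac1{2\pi i}\frac{df}{dz}$ and, for $k\in\mathbb R$, $D_kf=f'-\frac{k}{12}E_2f$, where $E_2=1-24q-\cdots$ is the Eisenstein series of weight $2$. Let $M=\bigoplus_{k\in\mathbb R}M_k$ with $M_k=\mathrm{Mer}$, where $(f,k)$ denotes the element $f$ of $M_k$; it is a graded commutative $\mathbb C$-algebra by $(f,k)(g,l)=(fg,k+l)$. Let $\delta$ be the linear endomorphism of $M$ with $\delta(f,k)=(D_kf,k+2)$. Let $\mathcal M=\bigoplus_{n\in2\mathbb Z}\mathcal M_n\subset M$ be the graded ring of holomorphic modular forms on $\mathrm{SL}(2,\mathbb Z)$, and let $\overline{\mathcal M}\subset M$ be the graded ring of meromorphic modular forms, that is, of the quotients $f/g$ with $f\in\mathcal M$ and $g\in\mathcal M$ homogeneous and nonzero; $\overline{\mathcal M}_k=\overline{\mathcal M}\cap M_k$. Let $\overline{\mathcal R}$ be the algebra of endomorphisms of $M$ generated by $\delta$ and the multiplications by elements of $\overline{\mathcal M}$ (the meromorphic modular linear differential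 operators, meromorphic MLDOs), and let $\overline{\mathcal R}_k$ be the set of those $a\in\overline{\mathcal R}$ with $a(M_l)\subset M_{l+k}$ for all $l\in\mathbb R$. For an integer $n\ge0$ let $\overline{\mathcal R}^n$ be the set of meromorphic MLDOs of order $n$, i.e. of the form $\sum_{i=0}^n c_i\delta^i$ with $c_i\in\overline{\mathcal M}$ and $c_n\ne0$. For $k\in\mathbb R$ put $$\overline S^n_k=\{\phi\in M_k\mid a\phi=0\text{ for some }a\in\overline{\mathcal R}^n\},$$ the set of solutions of weight $k$ of (not necessarily monic) modular linear differential equations of order $n$. Then for all integers $n,m\ge0$ and all $k,l\in\mathbb R$: 1. $\overline S^n_k+\overline S^m_k\subset\overline S^{n+m}_k$, i.e. $\phi+\psi\in\overline S^{n+m}_k$ for all $\phi\in\overline S^n_k$ and $\psi\in\overline S^m_k$; 2. $\overline S^n_k\,\overline S^m_l\subset\overline S^{nm}_{k+l}$, i.e. $\phi\psi\in\overline S^{nm}_{k+l}$ for all $\phi\in\overline S^n_k$ and $\psi\in\overline S^m_l$; 3. $\overline{\mathcal R}_k\,\overline S^m_l\subset\overline S^m_{k+l}$, i.e. $a\phi\in\overline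 S^m_{k+l}$ for all $a\in\overline{\mathcal R}_k$ and $\phi\in\overline S^m_l$; 4. $\overline{\mathcal M}_k\subset\overline S^1_k$. -/

import Mathlib

open scoped Pointwise MatrixGroups Manifold

noncomputable section

namespace MLDO

open UpperHalfPlane Filter

/-! ### Meromorphic functions on the upper half plane -/

/-- Functions `ℂ → ℂ` that are meromorphic at every point of the upper half plane. Their values off
the upper half plane and on discrete closed subsets of it are irrelevant and are divided out in
`Mer`. -/
def merFun : Subalgebra ℂ (ℂ → ℂ) where
  carrier := {f | MeromorphicOn f upperHalfPlaneSet}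
  mul_mem' hf hg := MeromorphicOn.mul hf hg
  add_mem' hf hg := MeromorphicOn.add hf hg
  algebraMap_mem' c := MeromorphicOn.const c

/-- The functions that vanish on the upper half plane outside a discrete closed subset of it. -/
def nullFun : Ideal merFun where
  carrier := {f | (f : ℂ → ℂ) =ᶠ[codiscreteWithin upperHalfPlaneSet] 0}
  add_mem' {f g} hf hg := by
    rw [Set.mem_ofPred_eq] at hf hg ⊢
    filter_upwards [hf, hg] with z h1 h2
    simp [h1, h2]
  zero_mem' := by
    rw [Set.mem_ofPred_eq]
    exact EventuallyEq.rfl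
  smul_mem' c f hf := by
    rw [Set.mem_ofPred_eq] at hf ⊢
    filter_upwards [hf] with z h
    simp [h]

theorem mem_nullFun {f : merFun} :
    f ∈ nullFun ↔ (f : ℂ → ℂ) =ᶠ[codiscreteWithin upperHalfPlaneSet] 0 := Iff.rfl

/-- `Mer`: the `ℂ`-algebra of meromorphic functions on the upper half plane. -/
abbrev Mer : Type := merFun ⧸ nullFun

/-- The class in `Mer` of a function that is meromorphic on the upper half plane. -/
abbrev Mer.mk (f : merFun) : Mer := Ideal.Quotient.mk nullFun f

theorem Mer.mk_eq_mk {f g : merFun} : Mer.mk f = Mer.mk g ↔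
    (f : ℂ → ℂ) =ᶠ[codiscreteWithin upperHalfPlaneSet] (g : ℂ → ℂ) := by
  rw [Ideal.Quotient.eq, mem_nullFun]
  exact (eventuallyEq_iff_sub (f := (f : ℂ → ℂ)) (g := (g : ℂ → ℂ))).symm

/-- A holomorphic function on the upper half plane, as an element of `Mer`. -/
def Mer.ofHol (f : ℍ → ℂ) (hf : MDiff f) : Mer :=
  Mer.mk ⟨f ∘ ofComplex, fun _ hz =>
    ((UpperHalfPlane.mdifferentiable_iff.mp hf).analyticAt (isOpen_upperHalfPlaneSet.mem_nhds hz)).meromorphicAt⟩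

/-- The derivative `f ↦ f' = (2πi)⁻¹ df/dz` on functions. -/
def derivFun (f : merFun) : merFun :=
  ⟨(2 * Real.pi * Complex.I : ℂ)⁻¹ • deriv (f : ℂ → ℂ), merFun.smul_mem (MeromorphicOn.deriv f.2) _⟩

theorem derivFun_congr {f g : merFun} (h : Mer.mk f = Mer.mk g) :
    Mer.mk (derivFun f) = Mer.mk (derivFun g) := by
  rw [Mer.mk_eq_mk] at h ⊢
  filter_upwards [MeromorphicOn.deriv_eventuallyEq_codiscreteWithin f.2 g.2 h] with z hz
  simp [derivFun, hz]

theorem deriv_ae (f : merFun) :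
    ∀ᶠ z in codiscreteWithin upperHalfPlaneSet, DifferentiableAt ℂ (f : ℂ → ℂ) z :=
  (MeromorphicOn.eventually_codiscreteWithin_analyticAt (f : ℂ → ℂ) f.2).mono
    fun _ h => h.differentiableAt

/-- The derivative `f ↦ f' = (2πi)⁻¹ df/dz` of meromorphic functions on the upper half plane. -/
def Mer.deriv : Mer →ₗ[ℂ] Mer where
  toFun := Quotient.lift (fun f => Mer.mk (derivFun f)) fun _ _ h =>
    derivFun_congr (Quotient.sound h)
  map_add' x y := by
    obtain ⟨f, rfl⟩ := Ideal.Quotient.mk_surjective x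
    obtain ⟨g, rfl⟩ := Ideal.Quotient.mk_surjective y
    change Mer.mk (derivFun (f + g)) = Mer.mk (derivFun f + derivFun g)
    rw [Mer.mk_eq_mk]
    filter_upwards [deriv_ae f, deriv_ae g] with z hf hg
    simp [derivFun, deriv_add hf hg, mul_add, add_comm]
  map_smul' c x := by
    obtain ⟨f, rfl⟩ := Ideal.Quotient.mk_surjective x
    change Mer.mk (derivFun (c • f)) = Mer.mk (c • derivFun f)
    rw [Mer.mk_eq_mk]
    filter_upwards [deriv_ae f] with z hf
    simp [derivFun, deriv_const_smul c hf, mul_left_comm]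

/-- The Eisenstein series `E₂ = 1 - 24 q - ⋯` as an element of `Mer`. -/
def Mer.E2 : Mer := Mer.ofHol EisensteinSeries.E2 E2_mdifferentiable

/-- The Ramanujan–Serre operator `D_k f = f' - (k / 12) E₂ f` on `Mer`, for `k` real. -/
def Mer.serre (k : ℝ) : Mer →ₗ[ℂ] Mer :=
  Mer.deriv - ((k : ℂ) / 12) • LinearMap.mulLeft ℂ Mer.E2

/-! ### The graded algebra `M` and the operator `δ` -/

/-- `M = ⨁_{k ∈ ℝ} M_k` with `M_k = Mer`: the element `(f, k)` of `M_k` is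
`AddMonoidAlgebra.single k f`, and `(f, k) (g, l) = (f g, k + l)`. -/
abbrev M : Type := AddMonoidAlgebra Mer ℝ

/-- The element `(f, k)` of `M_k`. -/
abbrev wt (f : Mer) (k : ℝ) : M := AddMonoidAlgebra.single k f

/-- The homogeneous component `M_k` as a subset of `M`. -/
def homog (k : ℝ) : Set M := {φ | ∃ f : Mer, φ = wt f k}

/-- The operator `δ` on `M`, determined by `δ (f, k) = (D_k f, k + 2)`. -/
def delta : Module.End ℂ M where
  toFun φ := φ.coeff.sum fun k f => wt (Mer.serre k f) (k + 2)
  map_add' φ ψ := by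
    rw [AddMonoidAlgebra.coeff_add, Finsupp.sum_add_index'] <;> simp
  map_smul' c φ := by
    rw [AddMonoidAlgebra.coeff_smul, Finsupp.sum_smul_index' (by simp)]
    simp [Finsupp.smul_sum]

theorem delta_wt (f : Mer) (k : ℝ) : delta (wt f k) = wt (Mer.serre k f) (k + 2) := by
  simp [delta]

/-! ### Meromorphic modular forms -/

/-- `𝓜 = ⨁_{n ∈ 2ℤ} 𝓜_n`, the holomorphic modular forms on `SL(2, ℤ)`, inside `M`. -/
def modForms : Submodule ℂ M :=
  Submodule.span ℂ {φ | ∃ n : ℤ, Even n ∧ ∃ f : ModularForm 𝒮ℒ n,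
    φ = wt (Mer.ofHol f f.holo') n}

/-- The meromorphic modular forms: the quotients `f / g` in `M` with `f ∈ 𝓜` and `g` a nonzero
homogeneous element of `𝓜`. -/
def merForms : Set M :=
  {φ | ∃ f ∈ modForms, ∃ g ∈ modForms, (∃ n : ℝ, g ∈ homog n) ∧ g ≠ 0 ∧ φ * g = f}

/-- The meromorphic modular forms of weight `k`. -/
def merFormsWt (k : ℝ) : Set M := merForms ∩ homog k

/-! ### Meromorphic modular linear differential operators -/

/-- The algebra of meromorphic MLDOs: the subalgebra of `End M` generated by `δ` and by the
multiplications by meromorphic modular forms. -/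
def merMLDO : Subalgebra ℂ (Module.End ℂ M) :=
  Algebra.adjoin ℂ ({delta} ∪ LinearMap.mulLeft ℂ '' merForms)

/-- The meromorphic MLDOs of weight `k`: those that map `M_l` into `M_{l + k}` for every `l`. -/
def merMLDOWt (k : ℝ) : Set (Module.End ℂ M) :=
  {a | a ∈ merMLDO ∧ ∀ l, ∀ φ ∈ homog l, a φ ∈ homog (l + k)}

/-- The meromorphic MLDOs of order (exactly) `n`: those of the form `∑_{i ≤ n} c_i δ^i` with
meromorphic modular forms `c_i` and `c_n ≠ 0`. -/
def merMLDOOrd (n : ℕ) : Set (Module.End ℂ M) :=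
  {a | a ∈ merMLDO ∧ ∃ c : ℕ → M, (∀ i, c i ∈ merForms) ∧ c n ≠ 0 ∧
    a = ∑ i ∈ Finset.range (n + 1), LinearMap.mulLeft ℂ (c i) * delta ^ i}

/-- The set of solutions of weight `k` to (not necessarily monic) MLDEs of order `n`: the elements
of `M_k` that are annihilated by some meromorphic MLDO of order `n`. -/
def sol (n : ℕ) (k : ℝ) : Set M := {φ | φ ∈ homog k ∧ ∃ a ∈ merMLDOOrd n, a φ = 0}

end MLDO

end

open scoped Pointwise MatrixGroups Manifold ModularForm

noncomputable section

/-! The meromorphic functions form a field, inside which the meromorphic modular functions of weight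
0 form a subfield K. Fix a nonzero meromorphic modular form e of weight 2. Then e⁻¹D_k (`conn`)
preserves weights: it is additive on `Mer` and satisfies the Leibniz rule over K, with derivation
e⁻¹D_0 on K.

The crux is `wt_mem_sol_iff`: (f, k) solves an equation of order n iff f lies in a K-subspace of
dimension at most n stable under `conn k`. Up to powers of e, an equation is a K-linear relation
among the iterates of f in which the n-th has nonzero coefficient (`iter_mem_span_of_sol`,
`sol_of_iter_mem_span`); such relations amount to stable subspaces by
`IsConnection.isFiniteFor_iff`.

The four claims become linear algebra. For stable V and W, the sum V + W and the product VW (an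
image of V ⊗ W) are stable; an operator of the algebra sends V into powers of e times V; a nonzero
modular form spans a stable line. -/

namespace MLDO

open UpperHalfPlane Filter

/-! ### Linear algebra: finite-dimensional subspaces stable under a connection. -/

section StableSubspaces

variable {K X : Type*} [Field K] [AddCommGroup X] [Module K X]

/-- The additive map `θ` satisfies the Leibniz rule with respect to scalars. -/
def IsConnection (K : Type*) {X : Type*} [Field K] [AddCommGroup X] [Module K X]
    (θ : X → X) : Prop :=
  (∀ x y, θ (x + y) = θ x + θ y) ∧ ∀ c : K, ∃ d : K, ∀ x, θ (c • x) = d • x + c • θ x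

/-- `x` lies in a subspace of dimension at most `n` that is stable under `θ`. -/
def IsFiniteFor (K : Type*) {X : Type*} [Field K] [AddCommGroup X] [Module K X]
    (θ : X → X) (n : ℕ) (x : X) : Prop :=
  ∃ V : Submodule K X, FiniteDimensional K V ∧ Module.finrank K V ≤ n ∧
    (∀ y ∈ V, θ y ∈ V) ∧ x ∈ V

theorem IsConnection.stable_span {θ : X → X} (hθ : IsConnection K θ) {s : Set X}
    {W : Submodule K X} (hs : ∀ x ∈ s, θ x ∈ W) (hsW : s ⊆ W) :
    ∀ x ∈ Submodule.span K s, θ x ∈ W := by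
  intro x hx
  induction hx using Submodule.span_induction with
  | mem x h => exact hs x h
  | zero =>
    have h := hθ.1 0 0
    rw [add_zero, left_eq_add] at h
    rw [h]
    exact W.zero_mem
  | add x y _ _ h1 h2 => rw [hθ.1]; exact W.add_mem h1 h2
  | smul c x hx h =>
    obtain ⟨d, hd⟩ := hθ.2 c
    rw [hd]
    exact W.add_mem (W.smul_mem _ (Submodule.span_le.2 hsW hx)) (W.smul_mem _ h)

/-- Each θ(vᵢ) is a combination of vᵢ and vᵢ₊₁, so the only vector that could leave the span is v_r.
The terms κᵢ allow for the change of weight when `delta` is iterated. -/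
theorem IsConnection.stable_span_of_mem {θ : X → X} (hθ : IsConnection K θ) {v : ℕ → X} {κ : ℕ → K}
    (hv : ∀ i, v (i + 1) = θ (v i) + κ i • v i) {r : ℕ}
    (hr : v r ∈ Submodule.span K (v '' Set.Iio r)) :
    ∀ x ∈ Submodule.span K (v '' Set.Iio r), θ x ∈ Submodule.span K (v '' Set.Iio r) := by
  refine hθ.stable_span ?_ Submodule.subset_span
  rintro _ ⟨i, hi, rfl⟩
  have hmem : ∀ j ≤ r, v j ∈ Submodule.span K (v '' Set.Iio r) := fun j hj => by
    rcases hj.lt_or_eq with h | rfl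
    · exact Submodule.subset_span ⟨j, h, rfl⟩
    · exact hr
  rw [show θ (v i) = v (i + 1) - κ i • v i by rw [hv]; abel]
  exact Submodule.sub_mem _ (hmem _ hi) (Submodule.smul_mem _ _ (hmem _ (le_of_lt hi)))

theorem exists_mem_span_image_Iio {v : ℕ → X} {n : ℕ} {V : Submodule K X} [FiniteDimensional K V]
    (hn : Module.finrank K V ≤ n) (hv : ∀ i, v i ∈ V) :
    ∃ r ≤ n, v r ∈ Submodule.span K (v '' Set.Iio r) := by
  by_contra! h
  -- Without a dependence up to index n the spans grow strictly, giving dimension n + 1 inside V.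
  have key : ∀ m ≤ n + 1, m ≤ Module.finrank K (Submodule.span K (v '' Set.Iio m)) := by
    intro m
    induction m with
    | zero => simp
    | succ m ih =>
      intro hm
      have : FiniteDimensional K (Submodule.span K (v '' Set.Iio (m + 1))) :=
        FiniteDimensional.span_of_finite K ((Set.finite_Iio _).image _)
      have hlt : Submodule.span K (v '' Set.Iio m) < Submodule.span K (v '' Set.Iio (m + 1)) := by
        refine SetLike.lt_iff_le_and_exists.2 ⟨Submodule.span_mono (Set.image_mono
          (Set.Iio_subset_Iio m.le_succ)), v m, Submodule.subset_span ⟨m, m.lt_succ_self, rfl⟩,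
          h m (by omega)⟩
      have := Submodule.finrank_lt_finrank_of_lt hlt
      have := ih (by omega)
      omega
  have h1 := key (n + 1) le_rfl
  have h2 : Submodule.span K (v '' Set.Iio (n + 1)) ≤ V := by
    rw [Submodule.span_le]
    rintro _ ⟨i, -, rfl⟩
    exact hv i
  have := Submodule.finrank_mono h2
  omega

open scoped Classical in
theorem IsConnection.isFiniteFor_iff {θ : X → X} (hθ : IsConnection K θ) {v : ℕ → X} {κ : ℕ → K}
    (hv : ∀ i, v (i + 1) = θ (v i) + κ i • v i) {n : ℕ} :
    IsFiniteFor K θ n (v 0) ↔ v n ∈ Submodule.span K (v '' Set.Iio n) := by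
  constructor
  · rintro ⟨V, _, hn, hV, h0⟩
    have hmem : ∀ (W : Submodule K X), (∀ y ∈ W, θ y ∈ W) → v 0 ∈ W → ∀ i, v i ∈ W := by
      intro W hW h i
      induction i with
      | zero => exact h
      | succ i ih => rw [hv]; exact W.add_mem (hW _ ih) (W.smul_mem _ ih)
    -- The dependence may occur at some r < n. The span of the first r vectors is then already
    -- stable, so it still contains vₙ; this yields order exactly n.
    obtain ⟨r, hr, h⟩ := exists_mem_span_image_Iio hn (hmem V hV h0)
    have h0 : v 0 ∈ Submodule.span K (v '' Set.Iio r) := by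
      rcases Nat.eq_zero_or_pos r with rfl | hr
      · exact h
      · exact Submodule.subset_span ⟨0, hr, rfl⟩
    exact Submodule.span_mono (Set.image_mono (Set.Iio_subset_Iio hr))
      (hmem _ (hθ.stable_span_of_mem hv h) h0 n)
  · intro h
    refine ⟨Submodule.span K (v '' Set.Iio n),
      FiniteDimensional.span_of_finite K ((Set.finite_Iio _).image _), ?_,
      hθ.stable_span_of_mem hv h, ?_⟩
    · have := finrank_span_finset_le_card (R := K) (s := (Finset.range n).image v)
      rw [Finset.coe_image, Finset.coe_range] at this
      exact this.trans (Finset.card_image_le.trans (by simp))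
    · rcases Nat.eq_zero_or_pos n with rfl | hr
      · exact h
      · exact Submodule.subset_span ⟨0, hr, rfl⟩

theorem IsFiniteFor.add {θ : X → X} (hθ : IsConnection K θ) {n m : ℕ} {x y : X}
    (hx : IsFiniteFor K θ n x) (hy : IsFiniteFor K θ m y) : IsFiniteFor K θ (n + m) (x + y) := by
  obtain ⟨V, _, hn, hV, hxV⟩ := hx
  obtain ⟨W, _, hm, hW, hyW⟩ := hy
  refine ⟨V ⊔ W, inferInstance, ?_, ?_, Submodule.add_mem_sup hxV hyW⟩
  · exact (Submodule.finrank_add_le_finrank_add_finrank V W).trans (add_le_add hn hm)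
  · intro z hz
    obtain ⟨a, ha, b, hb, rfl⟩ := Submodule.mem_sup.1 hz
    rw [hθ.1]
    exact Submodule.add_mem_sup (hV a ha) (hW b hb)

theorem IsFiniteFor.zero {θ : X → X} (hθ : IsConnection K θ) (n : ℕ) : IsFiniteFor K θ n 0 := by
  have h := hθ.1 0 0
  rw [add_zero, left_eq_add] at h
  exact ⟨⊥, inferInstance, by simp, by simp [h], Submodule.zero_mem _⟩

theorem IsFiniteFor.mul {A : Type*} [CommRing A] [Algebra K A] {θ θ' ζ : A → A}
    (hζ : IsConnection K ζ) (h : ∀ x y, ζ (x * y) = θ x * y + x * θ' y) {n m : ℕ} {x y : A}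
    (hx : IsFiniteFor K θ n x) (hy : IsFiniteFor K θ' m y) : IsFiniteFor K ζ (n * m) (x * y) := by
  obtain ⟨V, _, hn, hV, hxV⟩ := hx
  obtain ⟨W, _, hm, hW, hyW⟩ := hy
  refine ⟨V * W, ?_, ?_, ?_, Submodule.mul_mem_mul hxV hyW⟩
  · rw [← Submodule.mulMap_range]
    infer_instance
  · rw [← Submodule.mulMap_range]
    refine (LinearMap.finrank_range_le _).trans ?_
    rw [Module.finrank_tensorProduct]
    exact Nat.mul_le_mul hn hm
  · intro z hz
    induction hz using Submodule.mul_induction_on' with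
    | mem_mul_mem a ha b hb =>
      rw [h]
      exact Submodule.add_mem _ (Submodule.mul_mem_mul (hV a ha) hb)
        (Submodule.mul_mem_mul ha (hW b hb))
    | add a _ b _ h1 h2 => rw [hζ.1]; exact Submodule.add_mem _ h1 h2

theorem mem_span_image_Iio_of_sum_eq_zero {v : ℕ → X} {g : ℕ → K} {n : ℕ} (hgn : g n ≠ 0)
    (h : ∑ i ∈ Finset.range (n + 1), g i • v i = 0) :
    v n ∈ Submodule.span K (v '' Set.Iio n) := by
  rw [Finset.sum_range_succ] at h
  rw [← Submodule.smul_mem_iff _ hgn, eq_neg_of_add_eq_zero_right h]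
  refine Submodule.neg_mem _ (Submodule.sum_mem _ fun i hi => Submodule.smul_mem _ _ ?_)
  exact Submodule.subset_span ⟨i, Finset.mem_range.1 hi, rfl⟩

theorem exists_sum_eq_of_mem_span_image_Iio {v : ℕ → X} {n : ℕ} {x : X}
    (h : x ∈ Submodule.span K (v '' Set.Iio n)) :
    ∃ g : ℕ → K, ∑ i ∈ Finset.range n, g i • v i = x := by
  rw [← Finset.coe_range, Submodule.mem_span_image_finset_iff_exists_fun] at h
  obtain ⟨c, hc⟩ := h
  refine ⟨fun i => if hi : i ∈ Finset.range n then c ⟨i, hi⟩ else 0, ?_⟩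
  rw [← hc, ← Finset.sum_coe_sort]
  exact Finset.sum_congr rfl fun i _ => by simp only [dif_pos i.2]

end StableSubspaces

/-! ### The field of meromorphic functions. -/

theorem isPreconnected_upperHalfPlaneSet : IsPreconnected upperHalfPlaneSet :=
  (convex_halfSpace_im_gt 0).isPreconnected

theorem accPt_upperHalfPlaneSet {z : ℂ} (hz : z ∈ upperHalfPlaneSet) :
    AccPt z (𝓟 upperHalfPlaneSet) := by
  rw [accPt_iff_frequently_nhdsNE]
  exact Eventually.frequently (nhdsWithin_le_nhds (isOpen_upperHalfPlaneSet.mem_nhds hz))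

theorem eventuallyEq_zero_of_mem_nullFun {f : merFun} (hf : f ∈ nullFun) {z : ℂ}
    (hz : z ∈ upperHalfPlaneSet) : (f : ℂ → ℂ) =ᶠ[nhdsWithin z {z}ᶜ] 0 :=
  (f.2 z hz).eventuallyEq_zero_nhdsNE_of_eventuallyEq_zero_codiscreteWithin hz
    (accPt_upperHalfPlaneSet hz) hf

/-- Identity theorem: the half plane is connected, so infinite order of vanishing at one point would
spread to all points. -/
theorem eventually_ne_zero_of_notMem_nullFun {f : merFun} (hf : f ∉ nullFun) :
    ∀ᶠ z in codiscreteWithin upperHalfPlaneSet, (f : ℂ → ℂ) z ≠ 0 := by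
  have hmer : MeromorphicOn (f : ℂ → ℂ) upperHalfPlaneSet := f.2
  refine hmer.eventually_codiscreteWithin_apply_ne_zero ?_
  by_contra! h
  obtain ⟨x, hx, htop⟩ := h
  refine hf ?_
  rw [mem_nullFun, EventuallyEq, eventually_iff, mem_codiscreteWithin_iff_forall_mem_nhdsNE]
  intro y hy
  have hy' : meromorphicOrderAt (f : ℂ → ℂ) y = ⊤ := by
    by_contra hne
    exact hmer.meromorphicOrderAt_ne_top_of_isPreconnected isPreconnected_upperHalfPlaneSet
      hy hx hne htop
  filter_upwards [meromorphicOrderAt_eq_top_iff.1 hy'] with w hw using Or.inl hw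

/-- The pointwise inverse of a non-null function is meromorphic and inverts it off a discrete set.
-/
theorem nullFun_isMaximal : nullFun.IsMaximal := by
  rw [Ideal.isMaximal_iff]
  constructor
  · intro h
    have hz : Complex.I ∈ upperHalfPlaneSet := by simp [upperHalfPlaneSet]
    obtain ⟨w, hw⟩ := (eventuallyEq_zero_of_mem_nullFun h hz).exists
    simp at hw
  · intro J f hJ hf hfJ
    have hinv : (f : ℂ → ℂ)⁻¹ ∈ merFun := MeromorphicOn.inv f.2
    have h1 : (1 : merFun) - ⟨_, hinv⟩ * f ∈ nullFun := by
      rw [mem_nullFun]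
      filter_upwards [eventually_ne_zero_of_notMem_nullFun hf] with z hz
      simp [hz]
    have := J.add_mem (hJ h1) (J.mul_mem_left ⟨_, hinv⟩ hfJ)
    simpa using this

instance : nullFun.IsMaximal := nullFun_isMaximal

instance : Field Mer := Ideal.Quotient.field nullFun

theorem Mer.ofHol_eq_zero_iff {f : ℍ → ℂ} (hf : MDiff f) : Mer.ofHol f hf = 0 ↔ f = 0 := by
  constructor
  · intro h
    rw [Mer.ofHol, Ideal.Quotient.eq_zero_iff_mem] at h
    ext τ
    have h1 := eventuallyEq_zero_of_mem_nullFun h τ.im_pos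
    have hc : ContinuousAt (f ∘ ofComplex) τ :=
      ((UpperHalfPlane.mdifferentiable_iff.mp hf).differentiableAt
        (isOpen_upperHalfPlaneSet.mem_nhds τ.im_pos)).continuousAt
    have h2 : (f ∘ ofComplex) τ = 0 := by
      refine tendsto_nhds_unique (hc.tendsto.mono_left nhdsWithin_le_nhds)
        (Tendsto.congr' h1.symm tendsto_const_nhds)
    simpa [ofComplex_apply] using h2
  · rintro rfl
    rfl

/-! ### The Serre derivative: Leibniz rule and modularity. -/

theorem Mer.deriv_mul (x y : Mer) : Mer.deriv (x * y) = Mer.deriv x * y + x * Mer.deriv y := by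
  obtain ⟨f, rfl⟩ := Ideal.Quotient.mk_surjective x
  obtain ⟨g, rfl⟩ := Ideal.Quotient.mk_surjective y
  change Mer.mk (derivFun (f * g)) = Mer.mk (derivFun f * g + f * derivFun g)
  rw [Mer.mk_eq_mk]
  filter_upwards [deriv_ae f, deriv_ae g] with z hf hg
  simp [derivFun, _root_.deriv_mul hf hg]
  ring

theorem Mer.serre_apply (k : ℝ) (x : Mer) :
    Mer.serre k x = Mer.deriv x - ((k : ℂ) / 12) • (Mer.E2 * x) := rfl

theorem Mer.serre_mul (k l : ℝ) (x y : Mer) :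
    Mer.serre (k + l) (x * y) = Mer.serre k x * y + x * Mer.serre l y := by
  simp only [Mer.serre_apply, Mer.deriv_mul, Complex.ofReal_add, add_div, Algebra.smul_def,
    RingHom.map_add]
  ring

theorem isBoundedAtImInfty_normalizedDerivOfComplex {f : ℍ → ℂ} (hf : MDiff f)
    (hb : IsBoundedAtImInfty f) :
    IsBoundedAtImInfty (Derivative.normalizedDerivOfComplex f) := by
  rw [isBoundedAtImInfty_iff] at hb ⊢
  obtain ⟨B, A, hBA⟩ := hb
  -- Cauchy's estimate on the unit disc around z: the shift by 2 keeps the closed disc inside the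
  -- half plane and in the region where f is bounded by B.
  refine ⟨‖(2 * Real.pi * Complex.I : ℂ)⁻¹‖ * (B / 1), max A 0 + 2, fun z hz => ?_⟩
  rw [Derivative.normalizedDerivOfComplex, norm_mul]
  have him : ∀ w ∈ Metric.closedBall (z : ℂ) 1, max A 0 + 1 ≤ w.im := by
    intro w hw
    rw [mem_closedBall_iff_norm] at hw
    have h1 := (Complex.abs_im_le_norm (w - z)).trans hw
    rw [Complex.sub_im, abs_le] at h1
    have : (z : ℂ).im = z.im := rfl
    linarith [h1.1]
  have hpos : ∀ w ∈ Metric.closedBall (z : ℂ) 1, 0 < w.im := fun w hw => by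
    linarith [him w hw, le_max_right A 0]
  refine mul_le_mul_of_nonneg_left ?_ (norm_nonneg _)
  refine Complex.norm_deriv_le_of_forall_mem_sphere_norm_le one_pos ?_ ?_
  · refine DifferentiableOn.diffContOnCl_ball (U := upperHalfPlaneSet)
      (UpperHalfPlane.mdifferentiable_iff.mp hf) ?_
    exact fun w hw => hpos w hw
  · intro w hw
    have hw' := Metric.sphere_subset_closedBall hw
    rw [Function.comp_apply, ofComplex_apply_of_im_pos (hpos w hw')]
    refine hBA _ ?_
    have := him w hw'
    change A ≤ w.im
    linarith [le_max_left A 0]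

theorem isBoundedAtImInfty_serreDerivative {f : ℍ → ℂ} (hf : MDiff f)
    (hb : IsBoundedAtImInfty f) (k : ℂ) : IsBoundedAtImInfty (Derivative.serreDerivative k f) := by
  have h1 := isBoundedAtImInfty_normalizedDerivOfComplex hf hb
  have h2 : IsBoundedAtImInfty (fun z => k * 12⁻¹ * EisensteinSeries.E2 z * f z) :=
    ((const_boundedAtFilter atImInfty (k * 12⁻¹)).mul
      EisensteinSeries.isBoundedAtImInfty_E2).mul hb
  exact h1.sub h2

/-- The Serre derivative of a level one modular form. -/
def serreForm {n : ℤ} (f : ModularForm 𝒮ℒ n) : ModularForm 𝒮ℒ (n + 2) where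
  toFun := Derivative.serreDerivative n f
  slash_action_eq' := by
    rintro _ ⟨γ, rfl⟩
    exact Derivative.serreDerivative_slash_invariant f.holo'
      (f.slash_action_eq' _ ⟨γ, rfl⟩)
  holo' := Derivative.serreDerivative_mdifferentiable _ f.holo'
  bdd_at_cusps' {c} hc := by
    have hinv : ∀ γ : SL(2, ℤ), Derivative.serreDerivative n f ∣[(n + 2 : ℤ)] γ =
        Derivative.serreDerivative n f := fun γ =>
      Derivative.serreDerivative_slash_invariant f.holo' (f.slash_action_eq' _ ⟨γ, rfl⟩)
    -- All cusps are equivalent to ∞ under SL(2, ℤ), so invariance leaves only boundedness at ∞.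
    rw [Subgroup.IsArithmetic.isCusp_iff_isCusp_SL2Z] at hc
    rw [OnePoint.isBoundedAt_iff_forall_SL2Z hc]
    intro γ _
    rw [hinv γ]
    exact isBoundedAtImInfty_serreDerivative f.holo' (ModularFormClass.bdd_at_infty f) _

theorem serre_ofHol {f : ℍ → ℂ} (hf : MDiff f) (k : ℝ) :
    Mer.serre k (Mer.ofHol f hf) = Mer.ofHol (Derivative.serreDerivative k f)
      (Derivative.serreDerivative_mdifferentiable _ hf) := by
  rw [Mer.serre_apply]
  refine Mer.mk_eq_mk.2 ?_
  filter_upwards [self_mem_codiscreteWithin upperHalfPlaneSet] with z hz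
  simp [derivFun, Derivative.normalizedDerivOfComplex,
    ofComplex_apply_of_im_pos hz]
  ring

/-! ### Holomorphic and meromorphic modular forms, weight by weight. -/

/-- The holomorphic modular forms of weight `2 p`. -/
def holForms (p : ℤ) : Submodule ℂ Mer where
  carrier := {x | ∃ f : ModularForm 𝒮ℒ (2 * p), x = Mer.ofHol f f.holo'}
  add_mem' := by
    rintro _ _ ⟨f, rfl⟩ ⟨g, rfl⟩
    exact ⟨f + g, rfl⟩
  zero_mem' := ⟨0, rfl⟩
  smul_mem' := by
    rintro c _ ⟨f, rfl⟩
    exact ⟨c • f, rfl⟩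

theorem mul_mem_holForms {p q : ℤ} {x y : Mer} (hx : x ∈ holForms p) (hy : y ∈ holForms q) :
    x * y ∈ holForms (p + q) := by
  obtain ⟨f, rfl⟩ := hx
  obtain ⟨g, rfl⟩ := hy
  exact ⟨(f.mul g).mcast (by ring), rfl⟩

theorem one_mem_holForms : (1 : Mer) ∈ holForms 0 :=
  ⟨(1 : ModularForm 𝒮ℒ 0).mcast (by ring), rfl⟩

theorem serre_mem_holForms {p : ℤ} {x : Mer} (hx : x ∈ holForms p) :
    Mer.serre (2 * p) x ∈ holForms (p + 1) := by
  obtain ⟨f, rfl⟩ := hx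
  refine ⟨(serreForm f).mcast (by ring), ?_⟩
  rw [serre_ofHol]
  congr 1
  funext z
  simp [serreForm, ModularForm.mcast_apply]
  rfl

theorem wt_mem_modForms {p : ℤ} {x : Mer} (hx : x ∈ holForms p) : wt x (2 * p) ∈ modForms := by
  obtain ⟨f, rfl⟩ := hx
  exact Submodule.subset_span ⟨2 * p, even_two_mul p, f, by push_cast; rfl⟩

theorem coeff_mem_of_mem_modForms {φ : M} (hφ : φ ∈ modForms) :
    (∀ p : ℤ, φ.coeff (2 * p : ℝ) ∈ holForms p) ∧
      ∀ s : ℝ, (∀ p : ℤ, s ≠ 2 * p) → φ.coeff s = 0 := by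
  induction hφ using Submodule.span_induction with
  | mem x h =>
    obtain ⟨n, hn, f, rfl⟩ := h
    obtain ⟨r, rfl⟩ := even_iff_two_dvd.1 hn
    constructor
    · intro p
      rcases eq_or_ne r p with rfl | hne
      · rw [AddMonoidAlgebra.coeff_single]
        push_cast
        rw [Finsupp.single_eq_same]
        exact ⟨f, rfl⟩
      · rw [AddMonoidAlgebra.coeff_single, Finsupp.single_eq_of_ne]
        · exact Submodule.zero_mem _
        · intro h
          push_cast at h
          exact hne (by exact_mod_cast (mul_left_cancel₀ two_ne_zero h).symm)
    · intro s hs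
      rw [AddMonoidAlgebra.coeff_single, Finsupp.single_eq_of_ne]
      exact_mod_cast hs r
  | zero => simp
  | add x y _ _ h1 h2 =>
    refine ⟨fun p => ?_, fun s hs => ?_⟩
    · exact Submodule.add_mem _ (h1.1 p) (h2.1 p)
    · rw [AddMonoidAlgebra.coeff_add, Finsupp.add_apply, h1.2 s hs, h2.2 s hs, add_zero]
  | smul c x _ h =>
    refine ⟨fun p => ?_, fun s hs => ?_⟩
    · exact Submodule.smul_mem _ c (h.1 p)
    · rw [AddMonoidAlgebra.coeff_smul, Finsupp.smul_apply, h.2 s hs, smul_zero]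

/-- The meromorphic modular forms of weight `2 n`. -/
def ratForms (n : ℤ) : Set Mer :=
  {x | ∃ p q : ℤ, p = n + q ∧ ∃ a ∈ holForms p, ∃ b ∈ holForms q, b ≠ 0 ∧ x = a / b}

theorem zero_mem_ratForms (n : ℤ) : (0 : Mer) ∈ ratForms n :=
  ⟨n + 0, 0, rfl, 0, Submodule.zero_mem _, 1, one_mem_holForms, one_ne_zero, by simp⟩

theorem mem_ratForms_of_mem_holForms {n : ℤ} {x : Mer} (hx : x ∈ holForms n) : x ∈ ratForms n :=
  ⟨n, 0, by simp, x, hx, 1, one_mem_holForms, one_ne_zero, by simp⟩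

theorem add_mem_ratForms {n : ℤ} {x y : Mer} (hx : x ∈ ratForms n) (hy : y ∈ ratForms n) :
    x + y ∈ ratForms n := by
  obtain ⟨_, q, rfl, a, ha, b, hb, hb0, rfl⟩ := hx
  obtain ⟨_, q', rfl, a', ha', b', hb', hb0', rfl⟩ := hy
  refine ⟨_, q + q', rfl, a * b' + a' * b, Submodule.add_mem _ ?_ ?_, b * b',
    mul_mem_holForms hb hb', mul_ne_zero hb0 hb0', by field_simp⟩
  · convert mul_mem_holForms ha hb' using 2
    ring
  · convert mul_mem_holForms ha' hb using 2
    ring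

theorem mul_mem_ratForms {n m : ℤ} {x y : Mer} (hx : x ∈ ratForms n) (hy : y ∈ ratForms m) :
    x * y ∈ ratForms (n + m) := by
  obtain ⟨_, q, rfl, a, ha, b, hb, hb0, rfl⟩ := hx
  obtain ⟨_, q', rfl, a', ha', b', hb', hb0', rfl⟩ := hy
  refine ⟨_, q + q', rfl, a * a', ?_, b * b',
    mul_mem_holForms hb hb', mul_ne_zero hb0 hb0', by field_simp⟩
  convert mul_mem_holForms ha ha' using 2
  ring

theorem inv_mem_ratForms {n : ℤ} {x : Mer} (hx : x ∈ ratForms n) : x⁻¹ ∈ ratForms (-n) := by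
  rcases eq_or_ne x 0 with rfl | h0
  · rw [inv_zero]
    exact zero_mem_ratForms _
  obtain ⟨p, q, rfl, a, ha, b, hb, hb0, rfl⟩ := hx
  exact ⟨q, n + q, by ring, b, hb, a, ha, fun h => h0 (by rw [h, zero_div]), by rw [inv_div]⟩

theorem algebraMap_mem_ratForms (c : ℂ) : algebraMap ℂ Mer c ∈ ratForms 0 := by
  rw [Algebra.algebraMap_eq_smul_one]
  exact mem_ratForms_of_mem_holForms (Submodule.smul_mem _ c one_mem_holForms)

theorem serre_zero_one : Mer.serre 0 1 = 0 := by
  have h := Mer.serre_mul 0 0 1 1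
  rw [add_zero, mul_one, one_mul, mul_one, left_eq_add] at h
  exact h

/-- Apply the Leibniz rule to b⁻¹b = 1, using D_0 1 = 0. -/
theorem serre_inv (k : ℝ) {b : Mer} (hb : b ≠ 0) :
    Mer.serre (-k) b⁻¹ = -(Mer.serre k b) * (b⁻¹ * b⁻¹) := by
  have h := Mer.serre_mul (-k) k b⁻¹ b
  rw [neg_add_cancel, inv_mul_cancel₀ hb, serre_zero_one] at h
  refine mul_right_cancel₀ hb ?_
  rw [mul_assoc, mul_assoc, inv_mul_cancel₀ hb]
  linear_combination -h

theorem serre_mem_ratForms {n : ℤ} {x : Mer} (hx : x ∈ ratForms n) :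
    Mer.serre (2 * n) x ∈ ratForms (n + 1) := by
  obtain ⟨_, q, rfl, a, ha, b, hb, hb0, rfl⟩ := hx
  have h1 := Mer.serre_mul (2 * (n + q : ℤ)) (-(2 * q)) a b⁻¹
  have e1 : (2 * (n + q : ℤ) : ℝ) + -(2 * q) = 2 * n := by push_cast; ring
  rw [e1, serre_inv _ hb0] at h1
  rw [div_eq_mul_inv, h1]
  have hb' := inv_mem_ratForms (mem_ratForms_of_mem_holForms hb)
  refine add_mem_ratForms ?_ ?_
  · convert mul_mem_ratForms (mem_ratForms_of_mem_holForms (serre_mem_holForms ha)) hb' using 2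
    ring
  · have h2 := mul_mem_ratForms (mem_ratForms_of_mem_holForms
      (Submodule.neg_mem _ (serre_mem_holForms hb))) (mul_mem_ratForms hb' hb')
    convert mul_mem_ratForms (mem_ratForms_of_mem_holForms ha) h2 using 2
    ring

theorem wt_mem_merForms {n : ℤ} {x : Mer} (hx : x ∈ ratForms n) : wt x (2 * n) ∈ merForms := by
  obtain ⟨_, q, rfl, a, ha, b, hb, hb0, rfl⟩ := hx
  refine ⟨_, wt_mem_modForms ha, _, wt_mem_modForms hb, ⟨_, b, rfl⟩, ?_, ?_⟩
  · simpa [wt] using hb0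
  · rw [wt, wt, AddMonoidAlgebra.single_mul_single, div_mul_cancel₀ _ hb0]
    congr 1
    push_cast
    ring

/-- Since the denominator is homogeneous, the components of the quotient are those of f divided by
b, shifted by the weight of b. That weight is an even integer because b ≠ 0. -/
theorem coeff_of_mem_merForms {φ : M} (hφ : φ ∈ merForms) :
    (∀ n : ℤ, φ.coeff (2 * n : ℝ) ∈ ratForms n) ∧
      ∀ s : ℝ, (∀ n : ℤ, s ≠ 2 * n) → φ.coeff s = 0 := by
  obtain ⟨f, hf, g, hg, ⟨r, b, rfl⟩, hg0, h⟩ := hφ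
  have hb0 : b ≠ 0 := by simpa [wt] using hg0
  obtain ⟨q, rfl⟩ : ∃ q : ℤ, r = 2 * q := by
    by_contra! hr
    have := (coeff_mem_of_mem_modForms hg).2 r hr
    rw [AddMonoidAlgebra.coeff_single, Finsupp.single_eq_same] at this
    exact hb0 this
  have hb : b ∈ holForms q := by
    have := (coeff_mem_of_mem_modForms hg).1 q
    rwa [AddMonoidAlgebra.coeff_single, Finsupp.single_eq_same] at this
  have hc : ∀ s : ℝ, φ.coeff s = f.coeff (s + 2 * q) / b := fun s => by
    rw [eq_div_iff hb0, ← h, wt, AddMonoidAlgebra.coeff_mul_single_add]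
  constructor
  · intro n
    refine ⟨n + q, q, rfl, _, (coeff_mem_of_mem_modForms hf).1 (n + q), b, hb, hb0, ?_⟩
    rw [hc]
    congr 2
    push_cast
    ring
  · intro s hs
    rw [hc, (coeff_mem_of_mem_modForms hf).2, zero_div]
    intro p hp
    refine hs (p - q) ?_
    push_cast
    linarith

theorem zero_mem_merForms : (0 : M) ∈ merForms := by
  have h := wt_mem_merForms (zero_mem_ratForms 0)
  rwa [wt, AddMonoidAlgebra.single_zero] at h

/-! ### Modular functions and the weight-zero normalization. -/

/-- The field of meromorphic modular functions. -/
def modFunField : Subfield Mer where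
  carrier := ratForms 0
  mul_mem' hx hy := by simpa using mul_mem_ratForms hx hy
  one_mem' := mem_ratForms_of_mem_holForms one_mem_holForms
  add_mem' := add_mem_ratForms
  zero_mem' := zero_mem_ratForms 0
  neg_mem' {x} hx := by
    simpa using mul_mem_ratForms (mem_ratForms_of_mem_holForms
      (Submodule.neg_mem _ one_mem_holForms)) hx
  inv_mem' x hx := by simpa using inv_mem_ratForms hx

theorem exists_ratForm_one : ∃ e ∈ ratForms 1, e ≠ 0 := by
  have h : ∀ {k : ℕ} (hk : 3 ≤ k) (hk2 : Even k),
      Mer.ofHol (ModularForm.E hk) (ModularForm.E hk).holo' ≠ 0 := fun hk hk2 h =>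
    EisensteinSeries.E_ne_zero hk hk2 (DFunLike.coe_injective ((Mer.ofHol_eq_zero_iff _).1 h))
  -- The form is E₆/E₄; the indices 3 and 2 are half the weights.
  refine ⟨_, ⟨3, 2, by norm_num, _, ⟨ModularForm.E₆.mcast (by norm_num), rfl⟩, _,
    ⟨ModularForm.E₄.mcast (by norm_num), rfl⟩, h (by norm_num) (by decide), rfl⟩,
    div_ne_zero (h (by norm_num) (by decide)) (h (by norm_num) (by decide))⟩

/-- A nonzero meromorphic modular form of weight two. -/
def unif : Mer := exists_ratForm_one.choose

theorem unif_mem : unif ∈ ratForms 1 := exists_ratForm_one.choose_spec.1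

theorem unif_ne_zero : unif ≠ 0 := exists_ratForm_one.choose_spec.2

theorem unif_zpow_mem (n : ℤ) : unif ^ n ∈ ratForms n := by
  have hnat : ∀ m : ℕ, unif ^ m ∈ ratForms m := fun m => by
    induction m with
    | zero => simpa using mem_ratForms_of_mem_holForms one_mem_holForms
    | succ m ih =>
      rw [pow_succ]
      exact_mod_cast mul_mem_ratForms ih unif_mem
  obtain ⟨m, rfl | rfl⟩ := n.eq_nat_or_neg
  · exact_mod_cast hnat m
  · rw [zpow_neg]
    exact_mod_cast inv_mem_ratForms (hnat m)

theorem serre_zpow_unif_mul (k : ℝ) (n : ℤ) (f : Mer) :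
    Mer.serre (k + 2 * n) (unif ^ n * f) =
      unif ^ (n + 1) * (unif⁻¹ * Mer.serre k f + Mer.serre (2 * n) (unif ^ n) / unif ^ (n + 1) * f)
      := by
  have hn : unif ^ (n + 1) ≠ 0 := zpow_ne_zero _ unif_ne_zero
  have h : unif ^ (n + 1) * unif⁻¹ = unif ^ n := by
    rw [zpow_add_one₀ unif_ne_zero, mul_inv_cancel_right₀ unif_ne_zero]
  rw [add_comm k, Mer.serre_mul, mul_add, ← mul_assoc, h, ← mul_assoc, mul_div_cancel₀ _ hn]
  exact add_comm _ _

/-- The scalar by which `δ` on `e ^ n f` differs from `e ^ (n + 1)` times the connection on `f`,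
where `e` is the chosen form of weight two. -/
def twist (n : ℤ) : modFunField :=
  ⟨Mer.serre (2 * n) (unif ^ n) / unif ^ (n + 1), by
    have h := mul_mem_ratForms (serre_mem_ratForms (unif_zpow_mem n))
      (inv_mem_ratForms (unif_zpow_mem (n + 1)))
    rw [add_neg_cancel] at h
    rwa [div_eq_mul_inv]⟩

/-- The Ramanujan–Serre operator of weight `k`, normalized to weight zero. -/
def conn (k : ℝ) (f : Mer) : Mer := unif⁻¹ * Mer.serre k f

theorem serre_zpow_unif_mul_eq (k : ℝ) (n : ℤ) (f : Mer) :
    Mer.serre (k + 2 * n) (unif ^ n * f) = unif ^ (n + 1) * (conn k f + twist n • f) :=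
  serre_zpow_unif_mul k n f

theorem conn_mul (k l : ℝ) (f g : Mer) :
    conn (k + l) (f * g) = conn k f * g + f * conn l g := by
  rw [conn, Mer.serre_mul, conn, conn]
  ring

theorem isConnection_conn (k : ℝ) : IsConnection modFunField (conn k) := by
  refine ⟨fun x y => by simp only [conn, map_add, mul_add], fun c => ?_⟩
  refine ⟨⟨conn 0 c, ?_⟩, fun x => ?_⟩
  · have h := serre_mem_ratForms (n := 0) c.2
    rw [Int.cast_zero, mul_zero] at h
    have h2 := mul_mem_ratForms (inv_mem_ratForms unif_mem) h
    exact h2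
  · have h := conn_mul 0 k c x
    rw [zero_add] at h
    exact h

theorem conn_zpow_unif_mul (k : ℝ) (n : ℤ) (f : Mer) :
    conn (k + 2 * n) (unif ^ n * f) = unif ^ n * (conn k f + twist n • f) := by
  rw [conn, serre_zpow_unif_mul_eq, zpow_add_one₀ unif_ne_zero, mul_comm (unif ^ n) unif, mul_assoc,
    inv_mul_cancel_left₀ unif_ne_zero]

/-- The iterates of `δ` on `f` in weight `k`, normalized to weight zero. -/
def iter (k : ℝ) (f : Mer) : ℕ → Mer
  | 0 => f
  | i + 1 => conn k (iter k f i) + twist i • iter k f i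

theorem delta_pow_wt (k : ℝ) (f : Mer) (i : ℕ) :
    (delta ^ i) (wt f k) = wt (unif ^ (i : ℤ) * iter k f i) (k + 2 * (i : ℤ)) := by
  induction i with
  | zero => simp [iter]
  | succ i ih =>
    rw [pow_succ', Module.End.mul_apply, ih, delta_wt, serre_zpow_unif_mul_eq]
    congr 1
    push_cast
    ring

/-! ### Solutions as elements of stable subspaces. -/

theorem exists_zpow_unif_smul {n : ℤ} {x : Mer} (hx : x ∈ ratForms n) :
    ∃ c : modFunField, x = c * unif ^ n := by
  refine ⟨⟨x * (unif ^ n)⁻¹, ?_⟩, ?_⟩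
  · have h := mul_mem_ratForms hx (inv_mem_ratForms (unif_zpow_mem n))
    rw [add_neg_cancel] at h
    exact h
  · exact (inv_mul_cancel_right₀ (zpow_ne_zero _ unif_ne_zero) x).symm

theorem coeff_wt_self (f : Mer) (k : ℝ) : (wt f k).coeff k = f := by
  rw [AddMonoidAlgebra.coeff_single, Finsupp.single_eq_same]

theorem iter_mem_span_of_sol {n : ℕ} {k : ℝ} {f : Mer} (h : wt f k ∈ sol n k) :
    iter k f n ∈ Submodule.span modFunField (iter k f '' Set.Iio n) := by
  obtain ⟨-, a, ⟨-, c, hc, hcn, rfl⟩, ha⟩ := h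
  -- The coefficients need not be homogeneous. Choosing a nonzero component of cₙ, of weight 2j, and
  -- comparing components of weight k + 2(j + n) isolates a homogeneous equation with the same
  -- leading index.
  obtain ⟨j, hj⟩ : ∃ j : ℤ, (c n).coeff (2 * j) ≠ 0 := by
    by_contra! hcon
    refine hcn (AddMonoidAlgebra.ext (Finsupp.ext fun s => ?_))
    by_cases hs : ∃ j : ℤ, s = 2 * j
    · obtain ⟨j, rfl⟩ := hs
      exact hcon j
    · push Not at hs
      exact (coeff_of_mem_merForms (hc n)).2 s hs
  have hg : ∀ i, ∃ g : modFunField, (c i).coeff (2 * (j + n - i : ℤ)) * unif ^ (i : ℤ) =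
      g * unif ^ (j + n) := fun i => by
    refine exists_zpow_unif_smul ?_
    have := mul_mem_ratForms ((coeff_of_mem_merForms (hc i)).1 (j + n - i)) (unif_zpow_mem i)
    rw [sub_add_cancel] at this
    exact_mod_cast this
  choose g hg using hg
  have hgn : g n ≠ 0 := by
    intro h0
    have := hg n
    rw [h0, add_sub_cancel_right, ZeroMemClass.coe_zero, zero_mul] at this
    exact mul_ne_zero hj (zpow_ne_zero _ unif_ne_zero) this
  have hsum : ∑ i ∈ Finset.range (n + 1), g i • iter k f i = 0 := by
    have h1 : ∀ i ∈ Finset.range (n + 1),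
        (LinearMap.mulLeft ℂ (c i) * delta ^ i) (wt f k) =
          c i * wt (unif ^ (i : ℤ) * iter k f i) (k + 2 * (i : ℤ)) := fun i _ => by
      rw [Module.End.mul_apply, delta_pow_wt, LinearMap.mulLeft_apply]
    rw [LinearMap.sum_apply, Finset.sum_congr rfl h1] at ha
    have h2 := congrArg (fun φ : M => φ.coeff (2 * (j + n : ℤ) + k)) ha
    simp only [AddMonoidAlgebra.coeff_sum, Finsupp.finsetSum_apply] at h2
    have h3 : ∀ i ∈ Finset.range (n + 1),
        (c i * wt (unif ^ (i : ℤ) * iter k f i) (k + 2 * (i : ℤ))).coeff (2 * (j + n : ℤ) + k) =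
          unif ^ (j + n) * (g i • iter k f i) := fun i _ => by
      have e : (2 * (j + n : ℤ) + k : ℝ) = 2 * (j + n - i : ℤ) + (k + 2 * (i : ℤ)) := by
        push_cast; ring
      rw [e, wt, AddMonoidAlgebra.coeff_mul_single_add, ← mul_assoc, hg, Subfield.smul_def,
        smul_eq_mul]
      ring
    rw [Finset.sum_congr rfl h3, ← Finset.mul_sum] at h2
    exact (mul_eq_zero.1 h2).resolve_left (zpow_ne_zero _ unif_ne_zero)
  exact mem_span_image_Iio_of_sum_eq_zero hgn hsum

theorem sol_of_iter_mem_span {n : ℕ} {k : ℝ} {f : Mer}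
    (h : iter k f n ∈ Submodule.span modFunField (iter k f '' Set.Iio n)) : wt f k ∈ sol n k := by
  obtain ⟨g, hg⟩ := exists_sum_eq_of_mem_span_image_Iio h
  -- Since δⁱ(f, k) carries the factor eⁱ, coefficients with e⁻ⁱ give an operator of weight 0 that
  -- reproduces the relation among the iterates. The value 0 beyond n is a default.
  set c : ℕ → M := fun i => if i = n then wt (unif ^ (-(n : ℤ))) (2 * (-(n : ℤ) : ℤ)) else
    if i < n then wt (-(g i * unif ^ (-(i : ℤ)))) (2 * (-(i : ℤ) : ℤ)) else 0 with hcdef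
  have hc : ∀ i, c i ∈ merForms := by
    intro i
    simp only [hcdef]
    split_ifs
    · exact wt_mem_merForms (unif_zpow_mem _)
    · refine wt_mem_merForms ?_
      have := mul_mem_ratForms (-(g i)).2 (unif_zpow_mem (-(i : ℤ)))
      rw [zero_add] at this
      simpa using this
    · exact zero_mem_merForms
  refine ⟨⟨f, rfl⟩, _, ⟨?_, c, hc, ?_, rfl⟩, ?_⟩
  · refine Subalgebra.sum_mem _ fun i _ => Subalgebra.mul_mem _ ?_ (Subalgebra.pow_mem _ ?_ i)
    · exact Algebra.subset_adjoin (Or.inr ⟨c i, hc i, rfl⟩)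
    · exact Algebra.subset_adjoin (Or.inl rfl)
  · simp only [hcdef, if_true, wt]
    rw [Ne, AddMonoidAlgebra.single_eq_zero]
    exact zpow_ne_zero _ unif_ne_zero
  · rw [LinearMap.sum_apply, Finset.sum_range_succ]
    have h1 : ∀ i ∈ Finset.range n, (LinearMap.mulLeft ℂ (c i) * delta ^ i) (wt f k) =
        wt (-(g i • iter k f i)) k := fun i hi => by
      have hi' := Finset.mem_range.1 hi
      have hci : c i = wt (-(g i * unif ^ (-(i : ℤ)))) (2 * (-(i : ℤ) : ℤ)) := by
        simp only [hcdef, if_neg hi'.ne, if_pos hi']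
      rw [Module.End.mul_apply, delta_pow_wt, LinearMap.mulLeft_apply, hci, wt, wt,
        AddMonoidAlgebra.single_mul_single, zpow_neg, neg_mul, mul_assoc,
        inv_mul_cancel_left₀ (zpow_ne_zero _ unif_ne_zero)]
      congr 1
      push_cast
      ring
    have h2 : (LinearMap.mulLeft ℂ (c n) * delta ^ n) (wt f k) = wt (iter k f n) k := by
      have hcn : c n = wt (unif ^ (-(n : ℤ))) (2 * (-(n : ℤ) : ℤ)) := by
        simp only [hcdef, if_true]
      rw [Module.End.mul_apply, delta_pow_wt, LinearMap.mulLeft_apply, hcn, wt, wt,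
        AddMonoidAlgebra.single_mul_single, zpow_neg,
        inv_mul_cancel_left₀ (zpow_ne_zero _ unif_ne_zero)]
      congr 1
      push_cast
      ring
    rw [Finset.sum_congr rfl h1, h2, ← hg]
    have h3 := map_sum (AddMonoidAlgebra.singleAddHom (R := Mer) k)
      (fun i => -(g i • iter k f i)) (Finset.range n)
    simp only [AddMonoidAlgebra.singleAddHom_apply] at h3
    rw [← h3, ← AddMonoidAlgebra.single_add, Finset.sum_neg_distrib, neg_add_cancel,
      AddMonoidAlgebra.single_zero]

theorem wt_mem_sol_iff {n : ℕ} {k : ℝ} {f : Mer} :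
    wt f k ∈ sol n k ↔ IsFiniteFor modFunField (conn k) n f := by
  have h := (isConnection_conn k).isFiniteFor_iff (v := iter k f) (κ := fun i => twist i)
    (fun i => rfl) (n := n)
  exact ⟨fun hs => h.2 (iter_mem_span_of_sol hs), fun hf => sol_of_iter_mem_span (h.1 hf)⟩

theorem exists_of_mem_sol {n : ℕ} {k : ℝ} {φ : M} (h : φ ∈ sol n k) :
    ∃ f, φ = wt f k ∧ IsFiniteFor modFunField (conn k) n f := by
  obtain ⟨f, rfl⟩ := h.1
  exact ⟨f, rfl, wt_mem_sol_iff.1 h⟩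

/-! ### The action of operators on solutions. -/

/-- The elements of `M` whose component of weight `l + 2 j` lies in `e ^ j V` for all integers `j`
and whose other components vanish, where `e` is the chosen form of weight two. -/
def twistSpan (V : Submodule modFunField Mer) (l : ℝ) : Submodule ℂ M :=
  Submodule.span ℂ {φ | ∃ j : ℤ, ∃ v ∈ V, φ = wt (unif ^ j * v) (l + 2 * j)}

/-- The condition f ≠ 0 is essential: (0, s) is the zero of `M` for every s and so determines no
weight. -/
theorem wt_mem_twistSpan {V : Submodule modFunField Mer} {l s : ℝ} {f : Mer} (hf : f ≠ 0)
    (h : wt f s ∈ twistSpan V l) : ∃ j : ℤ, s = l + 2 * j ∧ ∃ v ∈ V, f = unif ^ j * v := by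
  have hsmul : ∀ (c : ℂ), ∀ v ∈ V, c • v ∈ V := fun c v hv => by
    have := V.smul_mem ⟨_, algebraMap_mem_ratForms c⟩ hv
    rwa [Subfield.smul_def, smul_eq_mul, ← Algebra.smul_def] at this
  have key : ∀ φ ∈ twistSpan V l, (∀ j : ℤ, ∃ v ∈ V, φ.coeff (l + 2 * j) = unif ^ j * v) ∧
      ∀ s, (∀ j : ℤ, s ≠ l + 2 * j) → φ.coeff s = 0 := by
    intro φ hφ
    induction hφ using Submodule.span_induction with
    | mem x hx =>
      obtain ⟨i, v, hv, rfl⟩ := hx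
      refine ⟨fun j => ?_, fun s hs => ?_⟩
      · rcases eq_or_ne j i with rfl | hne
        · exact ⟨v, hv, coeff_wt_self _ _⟩
        · refine ⟨0, V.zero_mem, ?_⟩
          rw [AddMonoidAlgebra.coeff_single, Finsupp.single_eq_of_ne, mul_zero]
          intro h
          exact hne (by exact_mod_cast mul_left_cancel₀ two_ne_zero (add_left_cancel h))
      · rw [AddMonoidAlgebra.coeff_single, Finsupp.single_eq_of_ne (hs i)]
    | zero => exact ⟨fun j => ⟨0, V.zero_mem, by simp⟩, by simp⟩
    | add x y _ _ h1 h2 =>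
      refine ⟨fun j => ?_, fun s hs => ?_⟩
      · obtain ⟨v, hv, e⟩ := h1.1 j
        obtain ⟨w, hw, e'⟩ := h2.1 j
        exact ⟨v + w, V.add_mem hv hw, by
          rw [AddMonoidAlgebra.coeff_add, Finsupp.add_apply, e, e', mul_add]⟩
      · rw [AddMonoidAlgebra.coeff_add, Finsupp.add_apply, h1.2 s hs, h2.2 s hs, add_zero]
    | smul c x _ h =>
      refine ⟨fun j => ?_, fun s hs => ?_⟩
      · obtain ⟨v, hv, e⟩ := h.1 j
        exact ⟨c • v, hsmul c v hv, by
          rw [AddMonoidAlgebra.coeff_smul, Finsupp.smul_apply, e, mul_smul_comm]⟩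
      · rw [AddMonoidAlgebra.coeff_smul, Finsupp.smul_apply, h.2 s hs, smul_zero]
  have hk := key _ h
  by_cases hs : ∃ j : ℤ, s = l + 2 * j
  · obtain ⟨j, rfl⟩ := hs
    obtain ⟨v, hv, e⟩ := hk.1 j
    rw [coeff_wt_self] at e
    exact ⟨j, rfl, v, hv, e⟩
  · push Not at hs
    have := hk.2 s hs
    rw [coeff_wt_self] at this
    exact absurd this hf

/-- It suffices to treat generators: δ maps eʲV into eʲ⁺¹V, and a form of weight 2n maps eʲV into
eⁿ⁺ʲV. -/
theorem merMLDO_mem_twistSpan {V : Submodule modFunField Mer} {l : ℝ}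
    (hV : ∀ v ∈ V, conn l v ∈ V) {a : Module.End ℂ M} (ha : a ∈ merMLDO) :
    ∀ φ ∈ twistSpan V l, a φ ∈ twistSpan V l := by
  have hspan : ∀ b : Module.End ℂ M,
      (∀ j : ℤ, ∀ v ∈ V, b (wt (unif ^ j * v) (l + 2 * j)) ∈ twistSpan V l) →
        ∀ φ ∈ twistSpan V l, b φ ∈ twistSpan V l := by
    intro b hb φ hφ
    induction hφ using Submodule.span_induction with
    | mem x hx =>
      obtain ⟨i, v, hv, rfl⟩ := hx
      exact hb i v hv
    | zero => rw [map_zero]; exact Submodule.zero_mem _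
    | add x y _ _ h1 h2 => rw [map_add]; exact Submodule.add_mem _ h1 h2
    | smul c x _ h => rw [map_smul]; exact Submodule.smul_mem _ _ h
  induction ha using Algebra.adjoin_induction with
  | mem b hb =>
    rcases hb with rfl | ⟨c, hc, rfl⟩
    · refine hspan _ fun j v hv => ?_
      rw [delta_wt, serre_zpow_unif_mul_eq]
      refine Submodule.subset_span ⟨j + 1, _, V.add_mem (hV v hv) (V.smul_mem (twist j) hv), ?_⟩
      congr 1
      push_cast
      ring
    · refine hspan _ fun j v hv => ?_
      rw [LinearMap.mulLeft_apply, ← AddMonoidAlgebra.sum_coeff_single c, Finsupp.sum,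
        Finset.sum_mul]
      refine Submodule.sum_mem _ fun s hs => ?_
      rw [Finsupp.mem_support_iff] at hs
      obtain ⟨n, rfl⟩ : ∃ n : ℤ, s = 2 * n := by
        by_contra! hcon
        exact hs ((coeff_of_mem_merForms hc).2 s hcon)
      obtain ⟨g, hg⟩ := exists_zpow_unif_smul ((coeff_of_mem_merForms hc).1 n)
      refine Submodule.subset_span ⟨n + j, g • v, V.smul_mem g hv, ?_⟩
      rw [wt, wt, AddMonoidAlgebra.single_mul_single, hg, zpow_add₀ unif_ne_zero,
        Subfield.smul_def, smul_eq_mul]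
      congr 1
      · push_cast
        ring
      · ring
  | algebraMap r =>
    intro φ hφ
    rw [Module.algebraMap_end_apply]
    exact Submodule.smul_mem _ _ hφ
  | add b c _ _ h1 h2 =>
    intro φ hφ
    exact Submodule.add_mem _ (h1 φ hφ) (h2 φ hφ)
  | mul b c _ _ h1 h2 =>
    intro φ hφ
    exact h1 _ (h2 φ hφ)

theorem merMLDOWt_apply_mem_sol {m : ℕ} {k l : ℝ} {a : Module.End ℂ M} (ha : a ∈ merMLDOWt k)
    {φ : M} (hφ : φ ∈ sol m l) : a φ ∈ sol m (k + l) := by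
  obtain ⟨f, rfl, V, hfd, hm, hV, hf⟩ := exists_of_mem_sol hφ
  obtain ⟨h, hh⟩ := ha.2 l _ ⟨f, rfl⟩
  rw [add_comm k l, hh, wt_mem_sol_iff]
  -- When the image vanishes, k need not be an even integer, and no power of e links the two
  -- weights.
  rcases eq_or_ne h 0 with rfl | h0
  · exact .zero (isConnection_conn _) m
  have hmem : a (wt f l) ∈ twistSpan V l := by
    refine merMLDO_mem_twistSpan hV ha.1 _ (Submodule.subset_span ⟨0, f, hf, ?_⟩)
    simp
  rw [hh] at hmem
  obtain ⟨j, hj, v, hv, rfl⟩ := wt_mem_twistSpan h0 hmem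
  rw [hj]
  -- Multiplication by eʲ carries V to a subspace stable under the connection of weight l + 2j,
  -- without raising the dimension.
  refine ⟨V.map (LinearMap.mulLeft modFunField (unif ^ j)), inferInstance,
    (Submodule.finrank_map_le _ _).trans hm, ?_, ⟨v, hv, rfl⟩⟩
  rintro _ ⟨w, hw, rfl⟩
  rw [LinearMap.mulLeft_apply, conn_zpow_unif_mul]
  exact ⟨_, V.add_mem (hV w hw) (V.smul_mem (twist j) hw), rfl⟩

theorem merFormsWt_subset_sol (k : ℝ) : merFormsWt k ⊆ sol 1 k := by
  rintro _ ⟨hf, f, rfl⟩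
  rw [wt_mem_sol_iff]
  rcases eq_or_ne f 0 with rfl | h0
  · exact .zero (isConnection_conn _) 1
  have hc := coeff_of_mem_merForms hf
  obtain ⟨n, rfl⟩ : ∃ n : ℤ, k = 2 * n := by
    by_contra! hcon
    have := hc.2 k hcon
    rw [coeff_wt_self] at this
    exact h0 this
  have hfn := hc.1 n
  rw [coeff_wt_self] at hfn
  refine ⟨Submodule.span modFunField {f}, inferInstance, ?_, ?_, Submodule.mem_span_singleton_self f⟩
  · rw [finrank_span_singleton h0]
  · refine (isConnection_conn _).stable_span ?_ Submodule.subset_span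
    rintro _ rfl
    -- The logarithmic derivative e⁻¹D_k f / f has weight 0, so it is a scalar in K and the line
    -- through f is stable.
    have h1 := mul_mem_ratForms (mul_mem_ratForms (inv_mem_ratForms unif_mem)
      (serre_mem_ratForms hfn)) (inv_mem_ratForms hfn)
    rw [show -1 + (n + 1) + -n = 0 by ring] at h1
    refine Submodule.mem_span_singleton.2 ⟨⟨_, h1⟩, ?_⟩
    rw [Subfield.smul_def, smul_eq_mul, inv_mul_cancel_right₀ h0, conn]

end MLDO

end

theorem mainTheorem8 :
    (∀ (n m : ℕ) (k : ℝ), MLDO.sol n k + MLDO.sol m k ⊆ MLDO.sol (n + m) k) ∧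
    (∀ (n m : ℕ) (k l : ℝ), MLDO.sol n k * MLDO.sol m l ⊆ MLDO.sol (n * m) (k + l)) ∧
    (∀ (m : ℕ) (k l : ℝ), ∀ a ∈ MLDO.merMLDOWt k, ∀ φ ∈ MLDO.sol m l,
      a φ ∈ MLDO.sol m (k + l)) ∧
    (∀ k : ℝ, MLDO.merFormsWt k ⊆ MLDO.sol 1 k) := by
  refine ⟨fun n m k => ?_, fun n m k l => ?_,
    fun m k l a ha φ hφ => MLDO.merMLDOWt_apply_mem_sol ha hφ, MLDO.merFormsWt_subset_sol⟩
  · rintro _ ⟨φ, hφ, ψ, hψ, rfl⟩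
    obtain ⟨f, rfl, hf⟩ := MLDO.exists_of_mem_sol hφ
    obtain ⟨g, rfl, hg⟩ := MLDO.exists_of_mem_sol hψ
    change MLDO.wt f k + MLDO.wt g k ∈ _
    rw [MLDO.wt, MLDO.wt, ← AddMonoidAlgebra.single_add, MLDO.wt_mem_sol_iff]
    exact hf.add (MLDO.isConnection_conn k) hg
  · rintro _ ⟨φ, hφ, ψ, hψ, rfl⟩
    obtain ⟨f, rfl, hf⟩ := MLDO.exists_of_mem_sol hφ
    obtain ⟨g, rfl, hg⟩ := MLDO.exists_of_mem_sol hψ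
    change MLDO.wt f k * MLDO.wt g l ∈ _
    rw [MLDO.wt, MLDO.wt, AddMonoidAlgebra.single_mul_single, MLDO.wt_mem_sol_iff]
    exact hf.mul (MLDO.isConnection_conn _) (MLDO.conn_mul k l) hg
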